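/- Let $E$ be a complex Hilbert space, $\delta T>0$, and let $H(t)$, $t\in[0,\delta T]$, be a (strongly measurable in operator norm) family of bounded self-adjoint operators on $E$ with $\|H(t)\|\le K$ and $H(t)=H(\delta T-t)$ for all $t\in[0,\delta T]$. Write $H_k=H(t_k)$, let $[A,B]=AB-BA$, and let $$\int d^kt := \int\!\cdots\!\int_{0\le t_k\le\dots\le t_1\le\delta T} dt_1\cdots dt_k .$$ Let $$U=\mathcal T\exp\Big(-i\int_0^{\delta T}H(t)\,dt\Big)=\sum_{n\ge0}(-i)^n\int d^nt\,H_1H_2\cdots H_n$$ be the time-ordered exponential, let $U_{\rm tar}=\exp\big(-i\int_0^{\delta T}H(t)\,dt\big)$, and define the Magnus terms $$\Omega_1=\int_0^{\delta T}H(t)\,dt,\qquad \Omega_2=\tfrac12\int d^2t\,[H_1,H_2],\qquad \Omega_3=\tfrac16\int d^3t\,\big([H_1,[H_2,H_3]]+[H_3,[H_2,H_1]]\big),$$ $$\Omega_4=\tfrac1{12}\int d^4t\,\big([[[H_1,H_2],H_3],H_4]+[H_1,[[H_2,H_3],H_4]]+[H_1,[H_2,[H_3,H_4]]]+[H_2,[H_3,[H_4,H_1]]]\big).$$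 Then $\Omega_2=0$ and $\Omega_4=0$. Moreover, there are universal constants $c,C>0$ (independent of $E$, $H$, $K$ and $\delta T$) such that $\|\Omega_3\|\le C(K\delta T)^3$ and, whenever $K\,\delta T\le c$: 1. $U=\exp(-i\Omega_1+i\Omega_3+R)$ for some bounded operator $R$ with $\|R\|\le C(K\delta T)^5$; 2. $\|U-U_{\rm tar}\|\le C(K\delta T)^3$; 3. $U_{\rm tar}^{-1/2}\,U\,U_{\rm tar}^{-1/2}=\exp(i\Omega_3+R')$ for some bounded operator $R'$ with $\|R'\|\le C(K\delta T)^5$, where $U_{\rm tar}^{-1/2}$ is the principal inverse square root of the unitary $U_{\rm tar}$. In particular, as $\delta T\to0$ with $K$ fixed, $U=\exp(-i\Omega_1+i\Omega_3+O(\delta T^5))$, $U-U_{\rm tar}=O(\delta T^3)$ and $U_{\rm tar}^{-1/2}UU_{\rm tar}^{-1/2}=\exp(i\Omega_3+O(\delta T^5))$. -/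

import Mathlib

open MeasureTheory

noncomputable section

namespace Magnus

/-- The ordered simplex `{(t₁, …, t_k) | 0 ≤ t_k ≤ … ≤ t₁ ≤ T}`
(the entry `t 0` is `t₁`, the entry `t 1` is `t₂`, and so on). -/
def simplex (k : ℕ) (T : ℝ) : Set (Fin k → ℝ) :=
  {t | (∀ i, t i ∈ Set.Icc 0 T) ∧ Antitone t}

variable {A : Type*} [NormedRing A] [NormedAlgebra ℂ A]

/-- `∫ dᵏt F(t₁, …, t_k)`, the integral over the ordered simplex with respect to Lebesgue measure. -/
def orderedIntegral (k : ℕ) (T : ℝ) (F : (Fin k → ℝ) → A) : A :=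
  ∫ t in simplex k T, F t

/-- The time-ordered exponential `𝒯 exp(-i ∫₀ᵀ H(t) dt)`, that is, the sum of the Dyson series
`∑ₙ (-i)ⁿ ∫ dⁿt H(t₁) H(t₂) ⋯ H(tₙ)` (later times to the left). -/
def timeOrderedExp (H : ℝ → A) (T : ℝ) : A :=
  ∑' n : ℕ, (-Complex.I) ^ n • orderedIntegral n T (fun t => (List.ofFn fun i => H (t i)).prod)

/-- `Ω₁`. -/
def Omega1 (H : ℝ → A) (T : ℝ) : A :=
  ∫ t in (0 : ℝ)..T, H t

/-- `Ω₂`; the bracket is the commutator `⁅a, b⁆ = a * b - b * a`. -/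
def Omega2 (H : ℝ → A) (T : ℝ) : A :=
  (1 / 2 : ℂ) • orderedIntegral 2 T (fun t => ⁅H (t 0), H (t 1)⁆)

/-- `Ω₃`. -/
def Omega3 (H : ℝ → A) (T : ℝ) : A :=
  (1 / 6 : ℂ) • orderedIntegral 3 T (fun t =>
    ⁅H (t 0), ⁅H (t 1), H (t 2)⁆⁆ + ⁅H (t 2), ⁅H (t 1), H (t 0)⁆⁆)

/-- `Ω₄`. -/
def Omega4 (H : ℝ → A) (T : ℝ) : A :=
  (1 / 12 : ℂ) • orderedIntegral 4 T (fun t =>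
    ⁅⁅⁅H (t 0), H (t 1)⁆, H (t 2)⁆, H (t 3)⁆ + ⁅H (t 0), ⁅⁅H (t 1), H (t 2)⁆, H (t 3)⁆⁆ +
      ⁅H (t 0), ⁅H (t 1), ⁅H (t 2), H (t 3)⁆⁆⁆ + ⁅H (t 1), ⁅H (t 2), ⁅H (t 3), H (t 0)⁆⁆⁆)

/-- `U_tar = exp(-i ∫₀ᵀ H(t) dt)`. -/
def Utar (H : ℝ → A) (T : ℝ) : A :=
  NormedSpace.exp ((-Complex.I) • ∫ t in (0 : ℝ)..T, H t)

/-- The principal inverse square root `U^{-1/2}` of a normal operator, through the continuous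
functional calculus (the principal branch of `z ↦ z^{-1/2}` is continuous off `(-∞, 0]`). -/
def invSqrt {E : Type*} [NormedAddCommGroup E] [InnerProductSpace ℂ E] [CompleteSpace E]
    (U : E →L[ℂ] E) : E →L[ℂ] E :=
  cfc (fun z : ℂ => z ^ (-(1 / 2) : ℂ)) U

end Magnus

end

/-!
Reversing time maps the ordered simplex onto itself and, when `H t = H (T - t)`, replaces a word
`H(t₁) ⋯ H(tₙ)` by the reversed word. The integrands of `Ω₂` and `Ω₄` are odd under this symmetry,
so both integrals vanish. Moreover the Dyson terms `Dₙ` agree with their anti-time-ordered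
counterparts, so `U⁻¹ U = 1` becomes `∑ⱼ (-1)ʲ Dⱼ Dₙ₋ⱼ = 0`. In degrees two and four this
determines `D₂ = Ω₁² / 2` and `D₄` from `D₁` and `D₃`, while integrating the double commutator gives
`D₃ = Ω₁³ / 6 + Ω₃`. Hence `U` agrees up to fifth order with
`exp x + y + (x y + y x) / 2`, where `x = -i Ω₁` and `y = i Ω₃`, and therefore with `exp (x + y)`;
conjugating by `exp (-x / 2)` removes `x` and leaves `exp y` up to fifth order. Near `0` the
exponential is a small Lipschitz perturbation of `1 + id`, so an error of size `ε` in the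
exponential is absorbed by a correction of size `2 ε` in the exponent.
-/

namespace Magnus

open NormedSpace (exp)

section Exponential

theorem norm_pow_succ_sub_pow_succ_le {A : Type*} [NormedRing A] {a b : A} {r : ℝ}
    (ha : ‖a‖ ≤ r) (hb : ‖b‖ ≤ r) (n : ℕ) :
    ‖a ^ (n + 1) - b ^ (n + 1)‖ ≤ ‖a - b‖ * ((n + 1) * r ^ n) := by
  induction n with
  | zero => simp
  | succ n ih =>
    have hpow : ‖a ^ (n + 1)‖ ≤ r ^ (n + 1) :=
      (norm_pow_le' a n.succ_pos).trans (pow_le_pow_left₀ (norm_nonneg _) ha _)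
    calc ‖a ^ (n + 1 + 1) - b ^ (n + 1 + 1)‖
        = ‖a ^ (n + 1) * (a - b) + (a ^ (n + 1) - b ^ (n + 1)) * b‖ := by
          rw [pow_succ a (n + 1), pow_succ b (n + 1), mul_sub, sub_mul, sub_add_sub_cancel]
      _ ≤ r ^ (n + 1) * ‖a - b‖ + ‖a - b‖ * ((n + 1) * r ^ n) * r :=
          norm_add_le_of_le (norm_mul_le_of_le hpow le_rfl) (norm_mul_le_of_le ih hb)
      _ = ‖a - b‖ * ((↑(n + 1) + 1) * r ^ (n + 1)) := by push_cast; ring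

variable {A : Type*} [NormedRing A] [NormedAlgebra ℂ A] {a b u x y v : A} {r : ℝ}

/-- The approximation `exp x + y + (x y + y x) / 2` to `exp (x + y)`. It is exact to total weight
four when `x` has weight one and `y` has weight three, as for the Magnus terms `Ω₁` and `Ω₃`. -/
noncomputable def expAddApprox (x y : A) : A :=
  exp x + (y + (1 / 2 : ℂ) • (x * y + y * x))

theorem norm_expAddApprox_sub_exp_le (h : ‖x‖ ≤ 1) : ‖expAddApprox x y - exp x‖ ≤ 2 * ‖y‖ := by
  have hxy : ‖x * y + y * x‖ ≤ 2 * ‖y‖ :=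
    (norm_add_le_of_le (norm_mul_le_of_le h le_rfl) (norm_mul_le_of_le le_rfl h)).trans_eq (by ring)
  rw [expAddApprox, add_sub_cancel_left]
  refine (norm_add_le _ _).trans ?_
  rw [norm_smul, show ‖(1 / 2 : ℂ)‖ = 1 / 2 by norm_num]
  linarith

variable [CompleteSpace A]

theorem norm_exp_sub_exp_sub_sum_le (ha : ‖a‖ ≤ r) (hb : ‖b‖ ≤ r) (hr : r < 1) (N : ℕ) :
    ‖exp a - exp b -
        ∑ n ∈ Finset.range N, ((n + 1).factorial : ℂ)⁻¹ • (a ^ (n + 1) - b ^ (n + 1))‖ ≤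
      ‖a - b‖ * r ^ N / (1 - r) := by
  have hr0 : 0 ≤ r := (norm_nonneg a).trans ha
  have hsum : HasSum (fun n : ℕ => ((n + 1).factorial : ℂ)⁻¹ • (a ^ (n + 1) - b ^ (n + 1)))
      (exp a - exp b) := by
    simpa [smul_sub] using (hasSum_nat_add_iff' 1).2
      ((NormedSpace.exp_series_hasSum_exp' (𝕂 := ℂ) a).sub
        (NormedSpace.exp_series_hasSum_exp' (𝕂 := ℂ) b))
  rw [norm_sub_rev]
  refine norm_sub_le_of_geometric_bound_of_hasSum hr (fun n => ?_) hsum N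
  have hfact : ((n + 1).factorial : ℝ)⁻¹ * (n + 1) ≤ 1 := by
    rw [inv_mul_le_iff₀ (by positivity), mul_one]
    exact_mod_cast Nat.self_le_factorial (n + 1)
  calc ‖((n + 1).factorial : ℂ)⁻¹ • (a ^ (n + 1) - b ^ (n + 1))‖
      = ((n + 1).factorial : ℝ)⁻¹ * ‖a ^ (n + 1) - b ^ (n + 1)‖ := by
        rw [norm_smul, norm_inv, Complex.norm_natCast]
    _ ≤ ((n + 1).factorial : ℝ)⁻¹ * (‖a - b‖ * ((n + 1) * r ^ n)) := by
        gcongr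
        exact norm_pow_succ_sub_pow_succ_le ha hb n
    _ = ((n + 1).factorial : ℝ)⁻¹ * (n + 1) * (‖a - b‖ * r ^ n) := by ring
    _ ≤ ‖a - b‖ * r ^ n := mul_le_of_le_one_left (by positivity) hfact

theorem norm_exp_sub_sum_le (hx : ‖x‖ ≤ r) (hr : r < 1) (N : ℕ) :
    ‖exp x - ∑ n ∈ Finset.range (N + 1), (n.factorial : ℂ)⁻¹ • x ^ n‖ ≤ r ^ (N + 1) / (1 - r) := by
  have hr0 : 0 ≤ r := (norm_nonneg x).trans hx
  have h := norm_exp_sub_exp_sub_sum_le hx (by simpa using hr0 : ‖(0 : A)‖ ≤ r) hr N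
  simp only [NormedSpace.exp_zero, ne_eq, Nat.succ_ne_zero, not_false_eq_true, zero_pow,
    sub_zero] at h
  rw [Finset.sum_range_succ', pow_zero, Nat.factorial_zero, Nat.cast_one, inv_one, one_smul,
    add_comm, ← sub_sub, pow_succ']
  refine h.trans ?_
  have : 0 < 1 - r := sub_pos.2 hr
  gcongr

theorem norm_exp_sub_exp_sub_sub_le (ha : ‖a‖ ≤ 1 / 4) (hb : ‖b‖ ≤ 1 / 4) :
    ‖exp a - exp b - (a - b)‖ ≤ 1 / 2 * ‖a - b‖ := by
  have h := norm_exp_sub_exp_sub_sum_le ha hb (by norm_num) 1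
  simp only [Finset.sum_range_one, zero_add, Nat.factorial_one, Nat.cast_one, inv_one, one_smul,
    pow_one] at h
  refine h.trans ?_
  rw [div_le_iff₀ (by norm_num)]
  linarith [norm_nonneg (a - b)]

theorem norm_exp_sub_one_le (hx : ‖x‖ ≤ 1 / 2) : ‖exp x - 1‖ ≤ 2 * ‖x‖ := by
  have h := norm_exp_sub_exp_sub_sum_le hx (by simp : ‖(0 : A)‖ ≤ 1 / 2) (by norm_num) 0
  simp only [Finset.sum_range_zero, NormedSpace.exp_zero, sub_zero, pow_zero] at h
  exact h.trans_eq (by ring)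

theorem norm_exp_sub_one_sub_le (hx : ‖x‖ ≤ 1 / 2) : ‖exp x - 1 - x‖ ≤ 2 * ‖x‖ ^ 2 := by
  have h := norm_exp_sub_exp_sub_sum_le le_rfl (by simp : ‖(0 : A)‖ ≤ ‖x‖) (by linarith) 1
  simp only [Finset.sum_range_one, zero_add, Nat.factorial_one, Nat.cast_one, inv_one, one_smul,
    pow_one, NormedSpace.exp_zero, sub_zero] at h
  refine h.trans ?_
  rw [div_le_iff₀ (by linarith)]
  nlinarith [sq_nonneg ‖x‖]

/-- On a small ball the exponential is `1/2`-close to the identity, so it is onto a neighbourhood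
of explicit size. -/
theorem exists_exp_add_eq (hx : ‖x‖ ≤ 1 / 8) (hu : ‖u - exp x‖ ≤ 1 / 16) :
    ∃ R : A, ‖R‖ ≤ 2 * ‖u - exp x‖ ∧ exp (x + R) = u := by
  have happrox : ApproximatesLinearOn (exp : A → A) (ContinuousLinearMap.id ℂ A)
      (Metric.closedBall 0 (1 / 4)) (1 / 2) := by
    intro a ha b hb
    rw [mem_closedBall_zero_iff] at ha hb
    simpa using norm_exp_sub_exp_sub_sub_le ha hb
  let idInverse : (ContinuousLinearMap.id ℂ A).NonlinearRightInverse :=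
    { toFun := id
      nnnorm := 1
      bound' := fun y => by simp
      right_inv' := fun _ => rfl }
  have hball : Metric.closedBall x (2 * ‖u - exp x‖) ⊆ Metric.closedBall 0 (1 / 4) := by
    refine Metric.closedBall_subset_closedBall' ?_
    rw [dist_zero_right]
    linarith
  have hmem : u ∈ Metric.closedBall (exp x)
      (((idInverse.nnnorm : ℝ)⁻¹ - (1 / 2 : NNReal)) * (2 * ‖u - exp x‖)) := by
    rw [mem_closedBall_iff_norm]
    simp only [idInverse, NNReal.coe_one, NNReal.coe_div, NNReal.coe_ofNat]
    linarith
  obtain ⟨z, hz, hzu⟩ :=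
    happrox.surjOn_closedBall_of_nonlinearRightInverse idInverse (by positivity) hball hmem
  exact ⟨z - x, mem_closedBall_iff_norm.1 hz, by rwa [add_sub_cancel]⟩

theorem norm_exp_add_sub_expAddApprox_le (h : ‖x‖ + ‖y‖ ≤ 1 / 2) :
    ‖exp (x + y) - expAddApprox x y‖ ≤ 2 * (‖x‖ + ‖y‖) ^ 2 * ‖y‖ + ‖y‖ ^ 2 := by
  set r := ‖x‖ + ‖y‖
  have hexp : ‖exp (x + y) - exp x - (y + (1 / 2 : ℂ) • ((x + y) ^ 2 - x ^ 2))‖ ≤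
      2 * r ^ 2 * ‖y‖ := by
    have hdiff := norm_exp_sub_exp_sub_sum_le (norm_add_le x y)
      (le_add_of_nonneg_right (norm_nonneg y) : ‖x‖ ≤ ‖x‖ + ‖y‖) (by linarith) 2
    simp only [Finset.sum_range_succ, Finset.sum_range_zero, zero_add, Nat.factorial_one,
      Nat.cast_one, inv_one, one_smul, pow_one, add_sub_cancel_left, Nat.reduceAdd,
      Nat.factorial_two, Nat.cast_ofNat, ← one_div (2 : ℂ)] at hdiff
    refine hdiff.trans ?_
    rw [div_le_iff₀ (by linarith)]
    nlinarith [mul_nonneg (norm_nonneg y) (sq_nonneg r)]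
  have hsq : ‖(1 / 2 : ℂ) • y ^ 2‖ ≤ ‖y‖ ^ 2 := by
    have := norm_pow_le' y two_pos
    rw [norm_smul, show ‖(1 / 2 : ℂ)‖ = 1 / 2 by norm_num]
    linarith [norm_nonneg (y ^ 2), sq_nonneg ‖y‖]
  have hsplit : exp (x + y) - expAddApprox x y =
      (exp (x + y) - exp x - (y + (1 / 2 : ℂ) • ((x + y) ^ 2 - x ^ 2))) + (1 / 2 : ℂ) • y ^ 2 := by
    have : (x + y) ^ 2 = x ^ 2 + (x * y + y * x) + y ^ 2 := by noncomm_ring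
    rw [this, expAddApprox]
    module
  rw [hsplit]
  exact norm_add_le_of_le hexp hsq

theorem norm_exp_mul_mul_exp_le (hv : ‖v‖ ≤ 1 / 2) (a : A) : ‖exp v * a * exp v‖ ≤ 4 * ‖a‖ := by
  have hd : ‖exp v - 1‖ ≤ 1 := (norm_exp_sub_one_le hv).trans (by linarith)
  have hl : ‖(exp v - 1) * a‖ ≤ 1 * ‖a‖ := norm_mul_le_of_le hd le_rfl
  have hr : ‖a * (exp v - 1)‖ ≤ ‖a‖ * 1 := norm_mul_le_of_le le_rfl hd
  calc ‖exp v * a * exp v‖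
      = ‖a + (exp v - 1) * a + a * (exp v - 1) + (exp v - 1) * a * (exp v - 1)‖ := by
        congr 1; noncomm_ring
    _ ≤ ‖a‖ + 1 * ‖a‖ + ‖a‖ * 1 + 1 * ‖a‖ * 1 :=
        norm_add_le_of_le (norm_add_le_of_le (norm_add_le_of_le le_rfl hl) hr)
          (norm_mul_le_of_le hl hd)
    _ = 4 * ‖a‖ := by ring

/-- The first-order terms of the conjugation cancel those subtracted from `y`. -/
theorem norm_exp_mul_sub_mul_exp_sub_le (hv : ‖v‖ ≤ 1 / 2) (y : A) :
    ‖exp v * (y - (v * y + y * v)) * exp v - y‖ ≤ 20 * ‖v‖ ^ 2 * ‖y‖ := by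
  have hd : ‖exp v - 1‖ ≤ 2 * ‖v‖ := norm_exp_sub_one_le hv
  have hw : ‖exp v - 1 - v‖ ≤ 2 * ‖v‖ ^ 2 := norm_exp_sub_one_sub_le hv
  set d := exp v - 1 with hd_def
  set q := v * y + y * v
  have hq : ‖q‖ ≤ 2 * ‖v‖ * ‖y‖ :=
    (norm_add_le_of_le (norm_mul_le v y) (norm_mul_le y v)).trans_eq (by ring)
  have hyq : ‖y - q‖ ≤ 2 * ‖y‖ := (norm_sub_le_of_le le_rfl hq).trans (by nlinarith [norm_nonneg y])
  have hexpand : exp v * (y - q) * exp v - y =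
      ((d - v) * y + y * (d - v)) - (d * q + q * d) + d * (y - q) * d := by
    rw [show exp v = 1 + d by rw [hd_def]; abel]
    simp only [q]
    noncomm_ring
  rw [hexpand]
  refine (norm_add_le_of_le (norm_sub_le_of_le
    (norm_add_le_of_le (norm_mul_le_of_le hw le_rfl) (norm_mul_le_of_le le_rfl hw))
    (norm_add_le_of_le (norm_mul_le_of_le hd hq) (norm_mul_le_of_le hq hd)))
    (norm_mul_le_of_le (norm_mul_le_of_le hd hyq) hd)).trans_eq ?_
  ring

theorem exp_neg_half_mul_exp_mul_exp_neg_half (x : A) :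
    exp ((-(1 / 2) : ℂ) • x) * exp x * exp ((-(1 / 2) : ℂ) • x) = 1 := by
  let _ : NormedAlgebra ℚ A := NormedAlgebra.restrictScalars ℚ ℂ A
  have hcomm : Commute ((-(1 / 2) : ℂ) • x) x := (Commute.refl x).smul_left _
  rw [← NormedSpace.exp_add_of_commute hcomm,
    ← NormedSpace.exp_add_of_commute ((Commute.refl _).add_left hcomm.symm),
    show (-(1 / 2) : ℂ) • x + x + (-(1 / 2) : ℂ) • x = 0 by module, NormedSpace.exp_zero]

theorem norm_conj_sub_exp_le (hx : ‖x‖ ≤ 1) (hy : ‖y‖ ≤ 1 / 2) (u : A) :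
    ‖exp ((-(1 / 2) : ℂ) • x) * u * exp ((-(1 / 2) : ℂ) • x) - exp y‖ ≤
      4 * ‖u - expAddApprox x y‖ + 5 * ‖x‖ ^ 2 * ‖y‖ + 2 * ‖y‖ ^ 2 := by
  set v := (-(1 / 2) : ℂ) • x with hv
  have hvx : ‖v‖ = ‖x‖ / 2 := by
    rw [hv, norm_smul, show ‖(-(1 / 2) : ℂ)‖ = 1 / 2 by norm_num]
    ring
  have hv_le : ‖v‖ ≤ 1 / 2 := by linarith
  have happrox : expAddApprox x y = exp x + (y - (v * y + y * v)) := by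
    rw [expAddApprox, hv, smul_mul_assoc, mul_smul_comm]
    module
  have hsplit : exp v * u * exp v - exp y = exp v * (u - expAddApprox x y) * exp v +
      (exp v * (y - (v * y + y * v)) * exp v - y) - (exp y - 1 - y) := by
    rw [happrox, ← sub_sub, mul_sub, mul_sub, sub_mul, sub_mul,
      exp_neg_half_mul_exp_mul_exp_neg_half]
    abel
  rw [hsplit]
  refine (norm_sub_le_of_le (norm_add_le_of_le (norm_exp_mul_mul_exp_le hv_le _)
    (norm_exp_mul_sub_mul_exp_sub_le hv_le y)) (norm_exp_sub_one_sub_le hy)).trans_eq ?_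
  rw [hvx]
  ring

end Exponential

section OrderedIntegral

theorem isClosed_simplex (n : ℕ) (T : ℝ) : IsClosed (simplex n T) := by
  have h : simplex n T = (⋂ i, {t : Fin n → ℝ | t i ∈ Set.Icc 0 T}) ∩ {t | Antitone t} := by
    ext t
    simp [simplex]
  rw [h]
  exact (isClosed_iInter fun i => isClosed_Icc.preimage (continuous_apply i)).inter
    isClosed_antitone

theorem measurableSet_simplex (n : ℕ) (T : ℝ) : MeasurableSet (simplex n T) :=
  (isClosed_simplex n T).measurableSet

theorem simplex_mono {n : ℕ} {S T : ℝ} (h : S ≤ T) : simplex n S ⊆ simplex n T :=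
  fun _ ht => ⟨fun i => ⟨(ht.1 i).1, (ht.1 i).2.trans h⟩, ht.2⟩

theorem simplex_zero (T : ℝ) : simplex 0 T = Set.univ :=
  Set.eq_univ_of_forall fun _ => ⟨fun i => i.elim0, fun i => i.elim0⟩

theorem antitone_cons_iff {n : ℕ} {x : ℝ} {t : Fin n → ℝ} :
    Antitone (Fin.cons x t : Fin (n + 1) → ℝ) ↔ (∀ i, t i ≤ x) ∧ Antitone t := by
  refine ⟨fun h => ⟨fun i => by simpa using h (Fin.zero_le i.succ),
    fun i j hij => by simpa using h (Fin.succ_le_succ_iff.2 hij)⟩, fun ⟨hx, ht⟩ i j hij => ?_⟩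
  cases i using Fin.cases with
  | zero => cases j using Fin.cases <;> simp [hx]
  | succ i =>
    cases j using Fin.cases with
    | zero => simp at hij
    | succ j => simpa using ht (Fin.succ_le_succ_iff.1 hij)

theorem cons_mem_simplex_iff {n : ℕ} {T x : ℝ} {t : Fin n → ℝ} :
    (Fin.cons x t : Fin (n + 1) → ℝ) ∈ simplex (n + 1) T ↔ x ∈ Set.Icc 0 T ∧ t ∈ simplex n x := by
  simp only [simplex, Set.mem_ofPred_eq, Fin.forall_fin_succ, Fin.cons_zero, Fin.cons_succ,
    antitone_cons_iff]
  exact ⟨fun ⟨⟨hx, ht⟩, htx, hanti⟩ => ⟨hx, fun i => ⟨(ht i).1, htx i⟩, hanti⟩,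
    fun ⟨hx, ht, hanti⟩ => ⟨⟨hx, fun i => ⟨(ht i).1, (ht i).2.trans hx.2⟩⟩,
      fun i => (ht i).2, hanti⟩⟩

theorem indicator_simplex_cons {E : Type*} [Zero E] {n : ℕ} (T x : ℝ) (F : (Fin (n + 1) → ℝ) → E)
    (t : Fin n → ℝ) :
    (simplex (n + 1) T).indicator F (Fin.cons x t) =
      (Set.Icc 0 T).indicator (fun x => (simplex n x).indicator (fun t => F (Fin.cons x t)) t)
        x := by
  classical
  simp only [Set.indicator_apply, cons_mem_simplex_iff, ite_and]

theorem piFinSuccAbove_zero_symm_apply {n : ℕ} (p : ℝ × (Fin n → ℝ)) :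
    (MeasurableEquiv.piFinSuccAbove (fun _ : Fin (n + 1) => ℝ) 0).symm p = Fin.cons p.1 p.2 := by
  simp [MeasurableEquiv.piFinSuccAbove, Fin.insertNthEquiv]

variable {A : Type*} [NormedRing A] {n : ℕ} {T : ℝ}

theorem integrableOn_simplex_cons {F : ℝ × (Fin n → ℝ) → A}
    (hF : IntegrableOn F (Set.Icc 0 T ×ˢ simplex n T)) :
    IntegrableOn (fun t => F (t 0, Fin.tail t)) (simplex (n + 1) T) := by
  have he := volume_preserving_piFinSuccAbove (fun _ : Fin (n + 1) => ℝ) 0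
  refine IntegrableOn.mono_set
    ((he.integrableOn_comp_preimage (MeasurableEquiv.measurableEmbedding _)).2 hF) fun t ht => ?_
  rw [← Fin.cons_self_tail t, cons_mem_simplex_iff] at ht
  exact ⟨ht.1, simplex_mono ht.1.2 ht.2⟩

theorem integrableOn_simplex_mul_tail {f : ℝ → A} {F : (Fin n → ℝ) → A}
    (hf : IntegrableOn f (Set.Icc 0 T)) (hF : IntegrableOn F (simplex n T)) :
    IntegrableOn (fun t => f (t 0) * F (Fin.tail t)) (simplex (n + 1) T) := by
  refine integrableOn_simplex_cons (F := fun p => f p.1 * F p.2) ?_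
  rw [IntegrableOn, Measure.volume_eq_prod, ← Measure.prod_restrict]
  exact hf.mul_prod hF

theorem integrableOn_simplex_tail_mul {f : ℝ → A} {F : (Fin n → ℝ) → A}
    (hf : IntegrableOn f (Set.Icc 0 T)) (hF : IntegrableOn F (simplex n T)) :
    IntegrableOn (fun t => F (Fin.tail t) * f (t 0)) (simplex (n + 1) T) := by
  refine integrableOn_simplex_cons (F := fun p => F p.2 * f p.1) ?_
  rw [IntegrableOn, Measure.volume_eq_prod, ← Measure.prod_restrict]
  exact (hF.mul_prod hf).swap

variable [NormedAlgebra ℂ A]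

theorem orderedIntegral_congr {F G : (Fin n → ℝ) → A} (h : Set.EqOn F G (simplex n T)) :
    orderedIntegral n T F = orderedIntegral n T G :=
  setIntegral_congr_fun (measurableSet_simplex n T) h

theorem orderedIntegral_zero [CompleteSpace A] (T : ℝ) (F : (Fin 0 → ℝ) → A) :
    orderedIntegral 0 T F = F 0 := by
  rw [orderedIntegral, simplex_zero, setIntegral_univ, volume_pi, Measure.pi_of_empty (x := 0),
    integral_dirac]

theorem orderedIntegral_succ (hT : 0 ≤ T) {F : (Fin (n + 1) → ℝ) → A}
    (hF : IntegrableOn F (simplex (n + 1) T)) :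
    orderedIntegral (n + 1) T F =
      ∫ x in (0 : ℝ)..T, orderedIntegral n x (fun t => F (Fin.cons x t)) := by
  have he := (volume_preserving_piFinSuccAbove (fun _ : Fin (n + 1) => ℝ) 0).symm
  have hemb :=
    (MeasurableEquiv.piFinSuccAbove (fun _ : Fin (n + 1) => ℝ) 0).symm.measurableEmbedding
  have hint := (he.integrable_comp_emb hemb).2 (hF.integrable_indicator (measurableSet_simplex _ _))
  rw [orderedIntegral, ← integral_indicator (measurableSet_simplex _ _), ← he.integral_comp hemb]
  rw [Measure.volume_eq_prod] at hint ⊢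
  refine (integral_prod _ hint).trans ?_
  rw [intervalIntegral.integral_of_le hT, ← integral_Icc_eq_integral_Ioc,
    ← integral_indicator measurableSet_Icc]
  simp only [Function.comp_apply, piFinSuccAbove_zero_symm_apply, indicator_simplex_cons]
  congr 1
  ext x
  by_cases hx : x ∈ Set.Icc 0 T
  · simp only [Set.indicator_of_mem hx]
    exact integral_indicator (measurableSet_simplex n x)
  · simp only [Set.indicator_of_notMem hx, integral_zero]

theorem orderedIntegral_mul_tail (hT : 0 ≤ T) {f : ℝ → A} {F : (Fin n → ℝ) → A}
    (hf : IntegrableOn f (Set.Icc 0 T)) (hF : IntegrableOn F (simplex n T)) :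
    orderedIntegral (n + 1) T (fun t => f (t 0) * F (Fin.tail t)) =
      ∫ x in (0 : ℝ)..T, f x * orderedIntegral n x F := by
  rw [orderedIntegral_succ hT (integrableOn_simplex_mul_tail hf hF)]
  refine intervalIntegral.integral_congr fun x hx => ?_
  rw [Set.uIcc_of_le hT] at hx
  simp only [Fin.cons_zero, Fin.tail_cons]
  exact integral_const_mul_of_integrable (hF.mono_set (simplex_mono hx.2))

theorem orderedIntegral_tail_mul (hT : 0 ≤ T) {f : ℝ → A} {F : (Fin n → ℝ) → A}
    (hf : IntegrableOn f (Set.Icc 0 T)) (hF : IntegrableOn F (simplex n T)) :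
    orderedIntegral (n + 1) T (fun t => F (Fin.tail t) * f (t 0)) =
      ∫ x in (0 : ℝ)..T, orderedIntegral n x F * f x := by
  rw [orderedIntegral_succ hT (integrableOn_simplex_tail_mul hf hF)]
  refine intervalIntegral.integral_congr fun x hx => ?_
  rw [Set.uIcc_of_le hT] at hx
  simp only [Fin.cons_zero, Fin.tail_cons]
  exact integral_mul_const_of_integrable (hF.mono_set (simplex_mono hx.2))

end OrderedIntegral

section TimeReversal

/-- The symmetry `(t₁, …, tₙ) ↦ (T - tₙ, …, T - t₁)` of the ordered simplex. -/
def timeReversal (n : ℕ) (T : ℝ) : (Fin n → ℝ) ≃ᵐ (Fin n → ℝ) :=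
  MeasurableEquiv.arrowCongr' Fin.revPerm (MeasurableEquiv.subLeft T)

theorem timeReversal_apply {n : ℕ} {T : ℝ} (t : Fin n → ℝ) (i : Fin n) :
    timeReversal n T t i = T - t i.rev :=
  rfl

theorem measurePreserving_timeReversal (n : ℕ) (T : ℝ) :
    MeasurePreserving (timeReversal n T) :=
  volume_preserving_arrowCongr' _ _ (Measure.measurePreserving_sub_left volume T)

theorem timeReversal_timeReversal {n : ℕ} {T : ℝ} (t : Fin n → ℝ) :
    timeReversal n T (timeReversal n T t) = t := by
  ext i
  simp [timeReversal_apply]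

theorem timeReversal_mem_simplex {n : ℕ} {T : ℝ} {t : Fin n → ℝ} (ht : t ∈ simplex n T) :
    timeReversal n T t ∈ simplex n T :=
  ⟨fun _ => ⟨sub_nonneg.2 (ht.1 _).2, sub_le_self _ (ht.1 _).1⟩,
    fun _ _ hij => sub_le_sub_left (ht.2 (Fin.rev_le_rev.2 hij)) T⟩

theorem preimage_timeReversal_simplex (n : ℕ) (T : ℝ) :
    timeReversal n T ⁻¹' simplex n T = simplex n T :=
  Set.Subset.antisymm
    (fun t ht => timeReversal_timeReversal (T := T) t ▸ timeReversal_mem_simplex ht)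
    fun _ => timeReversal_mem_simplex

variable {A : Type*} [NormedRing A] {n : ℕ} {T : ℝ} {F : (Fin n → ℝ) → A}

theorem integrableOn_simplex_comp_timeReversal (hF : IntegrableOn F (simplex n T)) :
    IntegrableOn (F ∘ timeReversal n T) (simplex n T) := by
  rw [← preimage_timeReversal_simplex]
  exact ((measurePreserving_timeReversal n T).integrableOn_comp_preimage
    (timeReversal n T).measurableEmbedding).2 hF

variable [NormedAlgebra ℂ A]

theorem orderedIntegral_comp_timeReversal (n : ℕ) (T : ℝ) (F : (Fin n → ℝ) → A) :
    orderedIntegral n T (F ∘ timeReversal n T) = orderedIntegral n T F := by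
  have h := (measurePreserving_timeReversal n T).setIntegral_preimage_emb
    (timeReversal n T).measurableEmbedding F (simplex n T)
  rwa [preimage_timeReversal_simplex] at h

theorem orderedIntegral_eq_zero_of_odd (h : Set.EqOn (F ∘ timeReversal n T) (-F) (simplex n T)) :
    orderedIntegral n T F = 0 := by
  have hneg : orderedIntegral n T F = -orderedIntegral n T F :=
    calc orderedIntegral n T F = orderedIntegral n T (-F) := by
          rw [← orderedIntegral_comp_timeReversal, orderedIntegral_congr h]
      _ = -orderedIntegral n T F := integral_neg _
  have := IsAddTorsionFree.of_isTorsionFree ℂ A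
  exact self_eq_neg.1 hneg

end TimeReversal

section RotaBaxter

theorem integral_intervalIntegral_eq_setIntegral {E : Type*} [NormedAddCommGroup E]
    [NormedSpace ℝ E] {T : ℝ} (hT : 0 ≤ T) {F : ℝ × ℝ → E}
    (hF : IntegrableOn F (Set.Ioc 0 T ×ˢ Set.Ioc 0 T)) {S : Set (ℝ × ℝ)} (hS : MeasurableSet S)
    (hSx : ∀ x, Prod.mk x ⁻¹' S =ᵐ[volume] Set.Iic x) :
    ∫ x in (0 : ℝ)..T, ∫ y in (0 : ℝ)..x, F (x, y) =
      ∫ p in S, F p ∂volume.restrict (Set.Ioc 0 T ×ˢ Set.Ioc 0 T) := by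
  rw [IntegrableOn, Measure.volume_eq_prod, ← Measure.prod_restrict] at hF
  rw [Measure.volume_eq_prod, ← Measure.prod_restrict, ← integral_indicator hS,
    integral_prod _ (hF.indicator hS), intervalIntegral.integral_of_le hT]
  refine setIntegral_congr_fun measurableSet_Ioc fun x hx => ?_
  calc ∫ y in (0 : ℝ)..x, F (x, y)
      = ∫ y in Set.Iic x, F (x, y) ∂volume.restrict (Set.Ioc 0 T) := by
        rw [intervalIntegral.integral_of_le hx.1.le, Measure.restrict_restrict measurableSet_Iic,
          Set.inter_comm, Set.Ioc_inter_Iic, inf_eq_right.2 hx.2]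
    _ = ∫ y in Prod.mk x ⁻¹' S, F (x, y) ∂volume.restrict (Set.Ioc 0 T) :=
        setIntegral_congr_set (ae_restrict_of_ae (hSx x).symm)
    _ = ∫ y in Set.Ioc 0 T, S.indicator F (x, y) :=
        (integral_indicator (measurable_prodMk_left hS)).symm

theorem setIntegral_Ioc_prod_Ioc {E : Type*} [NormedAddCommGroup E] [NormedSpace ℝ E] {T : ℝ}
    (hT : 0 ≤ T) {F : ℝ × ℝ → E} (hF : IntegrableOn F (Set.Ioc 0 T ×ˢ Set.Ioc 0 T)) :
    ∫ p in Set.Ioc 0 T ×ˢ Set.Ioc 0 T, F p =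
      (∫ x in (0 : ℝ)..T, ∫ y in (0 : ℝ)..x, F (x, y)) +
        ∫ x in (0 : ℝ)..T, ∫ y in (0 : ℝ)..x, F (y, x) := by
  have hle : MeasurableSet {p : ℝ × ℝ | p.2 ≤ p.1} := measurableSet_le measurable_snd measurable_fst
  have hlt : MeasurableSet {p : ℝ × ℝ | p.2 < p.1} := measurableSet_lt measurable_snd measurable_fst
  have hswap : MeasurePreserving (Prod.swap : ℝ × ℝ → ℝ × ℝ)
      (volume.restrict (Set.Ioc 0 T ×ˢ Set.Ioc 0 T))
      (volume.restrict (Set.Ioc 0 T ×ˢ Set.Ioc 0 T)) := by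
    rw [Measure.volume_eq_prod, ← Measure.prod_restrict]
    exact Measure.measurePreserving_swap
  have hsnd := integral_intervalIntegral_eq_setIntegral (F := F ∘ Prod.swap) hT hF.swap hlt
    fun x => Iio_ae_eq_Iic
  simp only [Function.comp_apply, Prod.swap_prod_mk] at hsnd
  rw [integral_intervalIntegral_eq_setIntegral hT hF hle fun _ => Filter.EventuallyEq.rfl, hsnd,
    ← integral_add_compl hle hF,
    ← hswap.setIntegral_preimage_emb MeasurableEquiv.prodComm.measurableEmbedding F
      {p | p.2 ≤ p.1}ᶜ]
  congr 3
  ext p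
  simp

theorem integral_prod_mul_of_integrable {α β A : Type*} [MeasurableSpace α] [MeasurableSpace β]
    {μ : Measure α} {ν : Measure β} [SFinite μ] [SFinite ν] [NormedRing A] [NormedAlgebra ℝ A]
    {f : α → A} {g : β → A} (hf : Integrable f μ) (hg : Integrable g ν) :
    ∫ p, f p.1 * g p.2 ∂μ.prod ν = (∫ x, f x ∂μ) * ∫ y, g y ∂ν := by
  rw [integral_prod _ (hf.mul_prod hg), ← integral_mul_const_of_integrable hf]
  simp only [integral_const_mul_of_integrable hg]

theorem integral_mul_integral {A : Type*} [NormedRing A] [NormedAlgebra ℝ A] {f g : ℝ → A} {T : ℝ}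
    (hT : 0 ≤ T) (hf : IntegrableOn f (Set.Icc 0 T)) (hg : IntegrableOn g (Set.Icc 0 T)) :
    (∫ x in (0 : ℝ)..T, f x) * (∫ x in (0 : ℝ)..T, g x) =
      (∫ x in (0 : ℝ)..T, f x * ∫ y in (0 : ℝ)..x, g y) +
        ∫ x in (0 : ℝ)..T, (∫ y in (0 : ℝ)..x, f y) * g x := by
  have hint : ∀ {h : ℝ → A}, IntegrableOn h (Set.Icc 0 T) → ∀ x ∈ Set.Icc 0 T,
      IntegrableOn h (Set.Ioc 0 x) := fun hh x hx =>
    hh.mono_set (Set.Ioc_subset_Icc_self.trans (Set.Icc_subset_Icc_right hx.2))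
  have hconst_mul : ∀ x ∈ Set.uIcc 0 T,
      f x * (∫ y in (0 : ℝ)..x, g y) = ∫ y in (0 : ℝ)..x, f x * g y := fun x hx => by
    rw [Set.uIcc_of_le hT] at hx
    simp only [intervalIntegral.integral_of_le hx.1,
      integral_const_mul_of_integrable (hint hg x hx)]
  have hmul_const : ∀ x ∈ Set.uIcc 0 T,
      (∫ y in (0 : ℝ)..x, f y) * g x = ∫ y in (0 : ℝ)..x, f y * g x := fun x hx => by
    rw [Set.uIcc_of_le hT] at hx
    simp only [intervalIntegral.integral_of_le hx.1,
      integral_mul_const_of_integrable (hint hf x hx)]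
  have hf' := hint hf T ⟨hT, le_rfl⟩
  have hg' := hint hg T ⟨hT, le_rfl⟩
  have hprod := integral_prod_mul_of_integrable hf' hg'
  have hfg := hf'.mul_prod hg'
  rw [Measure.prod_restrict, ← Measure.volume_eq_prod] at hfg hprod
  rw [intervalIntegral.integral_congr hconst_mul, intervalIntegral.integral_congr hmul_const,
    ← setIntegral_Ioc_prod_Ioc hT hfg, hprod, intervalIntegral.integral_of_le hT,
    intervalIntegral.integral_of_le hT]

end RotaBaxter

section Dyson

variable {A : Type*} [NormedRing A] {H : ℝ → A} {T : ℝ}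

theorem integrableOn_prod_ofFn (hH : IntegrableOn H (Set.Icc 0 T)) (n : ℕ) :
    IntegrableOn (fun t => (List.ofFn fun i => H (t i)).prod) (simplex n T) := by
  induction n with
  | zero =>
    simp only [List.ofFn_zero, List.prod_nil, simplex_zero]
    exact integrableOn_const isCompact_univ.measure_ne_top
  | succ n ih =>
    simp only [List.ofFn_succ, List.prod_cons]
    exact integrableOn_simplex_mul_tail hH ih

theorem integrableOn_prod_reverse_ofFn (hH : IntegrableOn H (Set.Icc 0 T)) (n : ℕ) :
    IntegrableOn (fun t => (List.ofFn fun i => H (t i)).reverse.prod) (simplex n T) := by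
  induction n with
  | zero =>
    simp only [List.ofFn_zero, List.reverse_nil, List.prod_nil, simplex_zero]
    exact integrableOn_const isCompact_univ.measure_ne_top
  | succ n ih =>
    simp only [List.ofFn_succ, List.reverse_cons, List.prod_append, List.prod_singleton]
    exact integrableOn_simplex_tail_mul hH ih

theorem integrableOn_lie_tail {n : ℕ} {f : ℝ → A} {F : (Fin n → ℝ) → A}
    (hf : IntegrableOn f (Set.Icc 0 T)) (hF : IntegrableOn F (simplex n T)) :
    IntegrableOn (fun t => ⁅f (t 0), F (Fin.tail t)⁆) (simplex (n + 1) T) :=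
  (integrableOn_simplex_mul_tail hf hF).sub (integrableOn_simplex_tail_mul hf hF)

theorem integrableOn_lie (hH : IntegrableOn H (Set.Icc 0 T)) :
    IntegrableOn (fun t => ⁅H (t 0), H (t 1)⁆) (simplex 2 T) := by
  have hH₁ : IntegrableOn (fun t : Fin 1 → ℝ => H (t 0)) (simplex 1 T) := by
    simpa using integrableOn_prod_ofFn hH 1
  exact integrableOn_lie_tail hH hH₁

theorem integrableOn_lie_lie (hH : IntegrableOn H (Set.Icc 0 T)) :
    IntegrableOn (fun t => ⁅H (t 0), ⁅H (t 1), H (t 2)⁆⁆) (simplex 3 T) :=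
  integrableOn_lie_tail hH (integrableOn_lie hH)

variable [NormedAlgebra ℂ A]

/-- The `n`-th Dyson term `∫ dⁿt H(t₁) ⋯ H(tₙ)`, encoded as an iterated primitive. -/
noncomputable def dyson (H : ℝ → A) : ℕ → ℝ → A
  | 0, _ => 1
  | n + 1, t => ∫ x in (0 : ℝ)..t, H x * dyson H n x

/-- The anti-time-ordered Dyson term `∫ dⁿt H(tₙ) ⋯ H(t₁)`, encoded as an iterated primitive. -/
noncomputable def dysonRev (H : ℝ → A) : ℕ → ℝ → A
  | 0, _ => 1
  | n + 1, t => ∫ x in (0 : ℝ)..t, dysonRev H n x * H x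

theorem dyson_one (H : ℝ → A) (T : ℝ) : dyson H 1 T = Omega1 H T := by
  simp [dyson, Omega1]

theorem dysonRev_one (H : ℝ → A) (T : ℝ) : dysonRev H 1 T = Omega1 H T := by
  simp [dysonRev, Omega1]

theorem continuousOn_dyson (hT : 0 ≤ T) (hH : IntegrableOn H (Set.Icc 0 T)) (n : ℕ) :
    ContinuousOn (dyson H n) (Set.Icc 0 T) := by
  induction n with
  | zero => exact continuousOn_const
  | succ n ih =>
    have hint := hH.mul_continuousOn ih isCompact_Icc
    rw [← Set.uIcc_of_le hT] at hint ⊢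
    exact intervalIntegral.continuousOn_primitive_interval hint

theorem continuousOn_dysonRev (hT : 0 ≤ T) (hH : IntegrableOn H (Set.Icc 0 T)) (n : ℕ) :
    ContinuousOn (dysonRev H n) (Set.Icc 0 T) := by
  induction n with
  | zero => exact continuousOn_const
  | succ n ih =>
    have hint := hH.continuousOn_mul ih isCompact_Icc
    rw [← Set.uIcc_of_le hT] at hint ⊢
    exact intervalIntegral.continuousOn_primitive_interval hint

theorem norm_dyson_succ_le (hT : 0 ≤ T) (hH : IntegrableOn H (Set.Icc 0 T)) (n : ℕ) :
    ‖dyson H (n + 1) T‖ ≤ (∫ t in (0 : ℝ)..T, ‖H t‖) ^ (n + 1) := by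
  induction n generalizing T with
  | zero =>
    rw [dyson_one, zero_add, pow_one]
    exact intervalIntegral.norm_integral_le_integral_norm hT
  | succ n ih =>
    have hnorm : IntervalIntegrable (fun t => ‖H t‖) volume 0 T :=
      (intervalIntegrable_iff_integrableOn_Icc_of_le hT).2 hH.norm
    have hbound : ∀ x ∈ Set.Ioc 0 T, ‖H x * dyson H (n + 1) x‖ ≤
        ‖H x‖ * (∫ t in (0 : ℝ)..T, ‖H t‖) ^ (n + 1) := fun x hx => by
      refine norm_mul_le_of_le le_rfl
        ((ih hx.1.le (hH.mono_set (Set.Icc_subset_Icc_right hx.2))).trans ?_)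
      refine pow_le_pow_left₀ (intervalIntegral.integral_nonneg hx.1.le fun _ _ => norm_nonneg _)
        (intervalIntegral.integral_mono_interval le_rfl hx.1.le hx.2
          (ae_of_all _ fun _ => norm_nonneg _) hnorm) _
    refine (intervalIntegral.norm_integral_le_of_norm_le hT (ae_of_all _ hbound)
      (hnorm.mul_const _)).trans_eq ?_
    rw [intervalIntegral.integral_mul_const, ← pow_succ']

theorem dysonRev_succ_mul_dyson_succ (hT : 0 ≤ T) (hH : IntegrableOn H (Set.Icc 0 T)) (j k : ℕ) :
    dysonRev H (j + 1) T * dyson H (k + 1) T =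
      (∫ x in (0 : ℝ)..T, dysonRev H j x * H x * dyson H (k + 1) x) +
        ∫ x in (0 : ℝ)..T, dysonRev H (j + 1) x * H x * dyson H k x := by
  have h := integral_mul_integral hT
    (hH.continuousOn_mul (continuousOn_dysonRev hT hH j) isCompact_Icc)
    (hH.mul_continuousOn (continuousOn_dyson hT hH k) isCompact_Icc)
  simp only [← mul_assoc] at h
  simpa only [dysonRev, dyson, mul_assoc] using h

/-- In degree `n + 1` this is the identity `U⁻¹ U = 1`, because `∑ⱼ iʲ dysonRev H j T` is the
inverse of the time-ordered exponential. -/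
theorem sum_neg_one_pow_smul_dysonRev_mul_dyson (hT : 0 ≤ T) (hH : IntegrableOn H (Set.Icc 0 T))
    (n : ℕ) :
    ∑ j ∈ Finset.range (n + 2), (-1 : ℤ) ^ j • (dysonRev H j T * dyson H (n + 1 - j) T) = 0 := by
  let M (j : ℕ) : A :=
    (-1 : ℤ) ^ j • ∫ x in (0 : ℝ)..T, dysonRev H j x * H x * dyson H (n - j) x
  have hfirst : dysonRev H 0 T * dyson H (n + 1) T = M 0 := by simp [M, dysonRev, dyson]
  have hlast : (-1 : ℤ) ^ (n + 1) • (dysonRev H (n + 1) T * dyson H 0 T) = -M n := by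
    simp [M, dysonRev, dyson, pow_succ]
  have hmiddle : ∀ j ∈ Finset.range n,
      (-1 : ℤ) ^ (j + 1) • (dysonRev H (j + 1) T * dyson H (n + 1 - (j + 1)) T) =
        M (j + 1) - M j := fun j hj => by
    obtain ⟨k, rfl⟩ := Nat.exists_eq_add_of_lt (Finset.mem_range.1 hj)
    simp only [M, show j + k + 1 + 1 - (j + 1) = k + 1 by omega,
      show j + k + 1 - (j + 1) = k by omega, show j + k + 1 - j = k + 1 by omega,
      dysonRev_succ_mul_dyson_succ hT hH]
    rw [pow_succ]
    module
  rw [Finset.sum_range_succ, Finset.sum_range_succ', Finset.sum_congr rfl hmiddle,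
    Finset.sum_range_sub, pow_zero, one_smul, Nat.sub_zero, Nat.sub_self, hfirst, hlast]
  abel

theorem dyson_two_add_dysonRev_two (hT : 0 ≤ T) (hH : IntegrableOn H (Set.Icc 0 T)) :
    dyson H 2 T + dysonRev H 2 T = Omega1 H T * Omega1 H T := by
  have h := dysonRev_succ_mul_dyson_succ hT hH 0 0
  rw [zero_add, dysonRev_one H T, dyson_one H T] at h
  simpa only [dysonRev, dyson, one_mul, mul_one] using h.symm

theorem Omega1_mul_dysonRev_two (hT : 0 ≤ T) (hH : IntegrableOn H (Set.Icc 0 T)) :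
    Omega1 H T * dysonRev H 2 T =
      (∫ x in (0 : ℝ)..T, H x * dysonRev H 2 x) + (∫ x in (0 : ℝ)..T, dyson H 2 x * H x) +
        dysonRev H 3 T := by
  have hint : ∀ {F : ℝ → A}, ContinuousOn F (Set.Icc 0 T) →
      IntervalIntegrable (fun x => F x * H x) volume 0 T := fun hF =>
    (intervalIntegrable_iff_integrableOn_Icc_of_le hT).2 (hH.continuousOn_mul hF isCompact_Icc)
  have hinner : ∫ x in (0 : ℝ)..T, Omega1 H x * (dysonRev H 1 x * H x) =
      ∫ x in (0 : ℝ)..T, (dyson H 2 x * H x + dysonRev H 2 x * H x) := by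
    refine intervalIntegral.integral_congr fun x hx => ?_
    rw [Set.uIcc_of_le hT] at hx
    simp only [← mul_assoc, ← add_mul, dysonRev_one,
      dyson_two_add_dysonRev_two hx.1 (hH.mono_set (Set.Icc_subset_Icc_right hx.2))]
  calc Omega1 H T * dysonRev H 2 T
      = (∫ x in (0 : ℝ)..T, H x * dysonRev H 2 x) +
          ∫ x in (0 : ℝ)..T, Omega1 H x * (dysonRev H 1 x * H x) :=
        integral_mul_integral hT hH
          (hH.continuousOn_mul (continuousOn_dysonRev hT hH 1) isCompact_Icc)
    _ = _ := by
        rw [hinner, intervalIntegral.integral_add (hint (continuousOn_dyson hT hH 2))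
          (hint (continuousOn_dysonRev hT hH 2)), ← add_assoc]
        rfl

theorem orderedIntegral_lie_tail {n : ℕ} {f : ℝ → A} {F : (Fin n → ℝ) → A} (hT : 0 ≤ T)
    (hf : IntegrableOn f (Set.Icc 0 T)) (hF : IntegrableOn F (simplex n T)) :
    orderedIntegral (n + 1) T (fun t => ⁅f (t 0), F (Fin.tail t)⁆) =
      (∫ x in (0 : ℝ)..T, f x * orderedIntegral n x F) -
        ∫ x in (0 : ℝ)..T, orderedIntegral n x F * f x := by
  rw [← orderedIntegral_mul_tail hT hf hF, ← orderedIntegral_tail_mul hT hf hF]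
  exact integral_sub (integrableOn_simplex_mul_tail hf hF) (integrableOn_simplex_tail_mul hf hF)

variable [CompleteSpace A]

theorem orderedIntegral_prod_ofFn (hT : 0 ≤ T) (hH : IntegrableOn H (Set.Icc 0 T)) (n : ℕ) :
    orderedIntegral n T (fun t => (List.ofFn fun i => H (t i)).prod) = dyson H n T := by
  induction n generalizing T with
  | zero => simp [orderedIntegral_zero, dyson]
  | succ n ih =>
    simp only [List.ofFn_succ, List.prod_cons]
    refine (orderedIntegral_mul_tail hT hH (integrableOn_prod_ofFn hH n)).trans
      (intervalIntegral.integral_congr fun x hx => ?_)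
    rw [Set.uIcc_of_le hT] at hx
    simp only [ih hx.1 (hH.mono_set (Set.Icc_subset_Icc_right hx.2))]

theorem orderedIntegral_prod_reverse_ofFn (hT : 0 ≤ T) (hH : IntegrableOn H (Set.Icc 0 T))
    (n : ℕ) :
    orderedIntegral n T (fun t => (List.ofFn fun i => H (t i)).reverse.prod) = dysonRev H n T := by
  induction n generalizing T with
  | zero => simp [orderedIntegral_zero, dysonRev]
  | succ n ih =>
    simp only [List.ofFn_succ, List.reverse_cons, List.prod_append, List.prod_singleton]
    refine (orderedIntegral_tail_mul hT hH (integrableOn_prod_reverse_ofFn hH n)).trans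
      (intervalIntegral.integral_congr fun x hx => ?_)
    rw [Set.uIcc_of_le hT] at hx
    simp only [ih hx.1 (hH.mono_set (Set.Icc_subset_Icc_right hx.2))]

theorem orderedIntegral_lie (hT : 0 ≤ T) (hH : IntegrableOn H (Set.Icc 0 T)) :
    orderedIntegral 2 T (fun t => ⁅H (t 0), H (t 1)⁆) = dyson H 2 T - dysonRev H 2 T := by
  have hH₁ : IntegrableOn (fun t : Fin 1 → ℝ => H (t 0)) (simplex 1 T) := by
    simpa using integrableOn_prod_ofFn hH 1
  have hD : ∀ x ∈ Set.uIcc 0 T, orderedIntegral 1 x (fun t => H (t 0)) = dyson H 1 x :=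
    fun x hx => by
      rw [Set.uIcc_of_le hT] at hx
      simpa using orderedIntegral_prod_ofFn hx.1 (hH.mono_set (Set.Icc_subset_Icc_right hx.2)) 1
  refine (orderedIntegral_lie_tail hT hH hH₁).trans (congrArg₂ _ ?_ ?_)
  · exact intervalIntegral.integral_congr fun x hx => congrArg (H x * ·) (hD x hx)
  · exact intervalIntegral.integral_congr fun x hx => congrArg (· * H x)
      ((hD x hx).trans ((dyson_one H x).trans (dysonRev_one H x).symm))

theorem orderedIntegral_lie_lie (hT : 0 ≤ T) (hH : IntegrableOn H (Set.Icc 0 T)) :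
    orderedIntegral 3 T (fun t => ⁅H (t 0), ⁅H (t 1), H (t 2)⁆⁆) =
      dyson H 3 T + (2 : ℂ) • dysonRev H 3 T - Omega1 H T * dysonRev H 2 T := by
  have hinner : ∀ x ∈ Set.uIcc 0 T, orderedIntegral 2 x (fun t => ⁅H (t 0), H (t 1)⁆) =
      dyson H 2 x - dysonRev H 2 x := fun x hx => by
    rw [Set.uIcc_of_le hT] at hx
    exact orderedIntegral_lie hx.1 (hH.mono_set (Set.Icc_subset_Icc_right hx.2))
  have hD := continuousOn_dyson hT hH 2
  have hR := continuousOn_dysonRev hT hH 2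
  have hleft : ∫ x in (0 : ℝ)..T, H x * orderedIntegral 2 x (fun t => ⁅H (t 0), H (t 1)⁆) =
      dyson H 3 T - ∫ x in (0 : ℝ)..T, H x * dysonRev H 2 x := by
    rw [intervalIntegral.integral_congr fun x hx => congrArg (H x * ·) (hinner x hx)]
    simp only [mul_sub]
    exact intervalIntegral.integral_sub
      ((intervalIntegrable_iff_integrableOn_Icc_of_le hT).2 (hH.mul_continuousOn hD isCompact_Icc))
      ((intervalIntegrable_iff_integrableOn_Icc_of_le hT).2 (hH.mul_continuousOn hR isCompact_Icc))
  have hright : ∫ x in (0 : ℝ)..T, orderedIntegral 2 x (fun t => ⁅H (t 0), H (t 1)⁆) * H x =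
      (∫ x in (0 : ℝ)..T, dyson H 2 x * H x) - dysonRev H 3 T := by
    rw [intervalIntegral.integral_congr fun x hx => congrArg (· * H x) (hinner x hx)]
    simp only [sub_mul]
    exact intervalIntegral.integral_sub
      ((intervalIntegrable_iff_integrableOn_Icc_of_le hT).2 (hH.continuousOn_mul hD isCompact_Icc))
      ((intervalIntegrable_iff_integrableOn_Icc_of_le hT).2 (hH.continuousOn_mul hR isCompact_Icc))
  calc orderedIntegral 3 T (fun t => ⁅H (t 0), ⁅H (t 1), H (t 2)⁆⁆)
      = (dyson H 3 T - ∫ x in (0 : ℝ)..T, H x * dysonRev H 2 x) -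
          ((∫ x in (0 : ℝ)..T, dyson H 2 x * H x) - dysonRev H 3 T) := by
        rw [← hleft, ← hright]
        exact orderedIntegral_lie_tail hT hH (integrableOn_lie hH)
    _ = dyson H 3 T + (2 : ℂ) • dysonRev H 3 T - Omega1 H T * dysonRev H 2 T := by
        rw [Omega1_mul_dysonRev_two hT hH]
        module

end Dyson

section TimeSymmetric

variable {A : Type*} {H : ℝ → A} {T : ℝ}

theorem apply_timeReversal (hsymm : ∀ t ∈ Set.Icc 0 T, H t = H (T - t)) {n : ℕ} {t : Fin n → ℝ}
    (ht : t ∈ simplex n T) (i : Fin n) : H (timeReversal n T t i) = H (t i.rev) :=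
  (hsymm _ (ht.1 _)).symm

variable [NormedRing A]

theorem prod_ofFn_timeReversal (hsymm : ∀ t ∈ Set.Icc 0 T, H t = H (T - t)) {n : ℕ}
    {t : Fin n → ℝ} (ht : t ∈ simplex n T) :
    (List.ofFn fun i => H (timeReversal n T t i)).prod =
      (List.ofFn fun i => H (t i)).reverse.prod := by
  simp only [apply_timeReversal hsymm ht]
  congr 1
  refine List.ext_getElem (by simp) fun i hi hi' => ?_
  simp only [List.getElem_ofFn, List.getElem_reverse, List.length_ofFn]
  congr 2
  ext
  simp only [Fin.val_rev]
  omega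

variable [NormedAlgebra ℂ A]

theorem Omega2_eq_zero (hsymm : ∀ t ∈ Set.Icc 0 T, H t = H (T - t)) : Omega2 H T = 0 := by
  rw [Omega2, orderedIntegral_eq_zero_of_odd, smul_zero]
  intro t ht
  simp only [Function.comp_apply, apply_timeReversal hsymm ht, Pi.neg_apply]
  rw [Ring.lie_def, Ring.lie_def, neg_sub]
  rfl

theorem Omega4_eq_zero (hsymm : ∀ t ∈ Set.Icc 0 T, H t = H (T - t)) : Omega4 H T = 0 := by
  rw [Omega4, orderedIntegral_eq_zero_of_odd, smul_zero]
  intro t ht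
  simp only [Function.comp_apply, apply_timeReversal hsymm ht, Pi.neg_apply]
  rw [show (0 : Fin 4).rev = 3 from rfl, show (1 : Fin 4).rev = 2 from rfl,
    show (2 : Fin 4).rev = 1 from rfl, show (3 : Fin 4).rev = 0 from rfl]
  simp only [Ring.lie_def]
  noncomm_ring

theorem Omega3_eq_smul_orderedIntegral (hH : IntegrableOn H (Set.Icc 0 T))
    (hsymm : ∀ t ∈ Set.Icc 0 T, H t = H (T - t)) :
    Omega3 H T = (1 / 3 : ℂ) • orderedIntegral 3 T (fun t => ⁅H (t 0), ⁅H (t 1), H (t 2)⁆⁆) := by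
  set F : (Fin 3 → ℝ) → A := fun t => ⁅H (t 0), ⁅H (t 1), H (t 2)⁆⁆ with hF
  have hreflect : Set.EqOn
      (fun t => ⁅H (t 0), ⁅H (t 1), H (t 2)⁆⁆ + ⁅H (t 2), ⁅H (t 1), H (t 0)⁆⁆)
      (F + F ∘ timeReversal 3 T) (simplex 3 T) := fun t ht => by
    simp only [hF, Pi.add_apply, Function.comp_apply, apply_timeReversal hsymm ht]
    rfl
  have hsum : orderedIntegral 3 T (F + F ∘ timeReversal 3 T) =
      orderedIntegral 3 T F + orderedIntegral 3 T (F ∘ timeReversal 3 T) :=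
    integral_add' (integrableOn_lie_lie hH)
      (integrableOn_simplex_comp_timeReversal (integrableOn_lie_lie hH))
  rw [Omega3, orderedIntegral_congr hreflect, hsum, orderedIntegral_comp_timeReversal]
  module

variable [CompleteSpace A]

theorem dysonRev_eq_dyson (hT : 0 ≤ T) (hH : IntegrableOn H (Set.Icc 0 T))
    (hsymm : ∀ t ∈ Set.Icc 0 T, H t = H (T - t)) (n : ℕ) : dysonRev H n T = dyson H n T := by
  rw [← orderedIntegral_prod_ofFn hT hH, ← orderedIntegral_prod_reverse_ofFn hT hH,
    ← orderedIntegral_comp_timeReversal n T fun t => (List.ofFn fun i => H (t i)).prod]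
  exact orderedIntegral_congr fun t ht => (prod_ofFn_timeReversal hsymm ht).symm

theorem dyson_two_eq (hT : 0 ≤ T) (hH : IntegrableOn H (Set.Icc 0 T))
    (hsymm : ∀ t ∈ Set.Icc 0 T, H t = H (T - t)) :
    dyson H 2 T = (1 / 2 : ℂ) • Omega1 H T ^ 2 := by
  have h := dyson_two_add_dysonRev_two hT hH
  rw [dysonRev_eq_dyson hT hH hsymm] at h
  rw [pow_two, ← h]
  module

theorem dyson_three_eq (hT : 0 ≤ T) (hH : IntegrableOn H (Set.Icc 0 T))
    (hsymm : ∀ t ∈ Set.Icc 0 T, H t = H (T - t)) :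
    dyson H 3 T = (1 / 6 : ℂ) • Omega1 H T ^ 3 + Omega3 H T := by
  rw [Omega3_eq_smul_orderedIntegral hH hsymm, orderedIntegral_lie_lie hT hH,
    dysonRev_eq_dyson hT hH hsymm, dysonRev_eq_dyson hT hH hsymm, dyson_two_eq hT hH hsymm,
    mul_smul_comm, ← pow_succ']
  module

theorem dyson_four_eq (hT : 0 ≤ T) (hH : IntegrableOn H (Set.Icc 0 T))
    (hsymm : ∀ t ∈ Set.Icc 0 T, H t = H (T - t)) :
    dyson H 4 T = (1 / 24 : ℂ) • Omega1 H T ^ 4 +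
      (1 / 2 : ℂ) • (Omega1 H T * Omega3 H T + Omega3 H T * Omega1 H T) := by
  have h := sum_neg_one_pow_smul_dysonRev_mul_dyson hT hH 3
  simp only [dysonRev_eq_dyson hT hH hsymm, Finset.sum_range_succ, Finset.sum_range_zero,
    Nat.reduceAdd, Nat.reduceSub, dyson_one, dyson_two_eq hT hH hsymm,
    dyson_three_eq hT hH hsymm, show dyson H 0 T = 1 from rfl] at h
  simp only [mul_add, add_mul, one_mul, mul_one, mul_smul_comm, smul_mul_assoc,
    ← pow_succ, ← pow_succ', ← pow_add, smul_smul] at h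
  linear_combination (norm := module) (1 / 2 : ℂ) • h

theorem sum_range_five_smul_dyson_eq (hT : 0 ≤ T) (hH : IntegrableOn H (Set.Icc 0 T))
    (hsymm : ∀ t ∈ Set.Icc 0 T, H t = H (T - t)) (z : ℂ) :
    ∑ n ∈ Finset.range 5, z ^ n • dyson H n T =
      ∑ n ∈ Finset.range 5, (n.factorial : ℂ)⁻¹ • (z • Omega1 H T) ^ n +
        (z ^ 3 • Omega3 H T + (1 / 2 : ℂ) •
          (z • Omega1 H T * z ^ 3 • Omega3 H T + z ^ 3 • Omega3 H T * z • Omega1 H T)) := by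
  simp only [Finset.sum_range_succ, Finset.sum_range_zero, dyson_one, dyson_two_eq hT hH hsymm,
    dyson_three_eq hT hH hsymm, dyson_four_eq hT hH hsymm, show dyson H 0 T = 1 from rfl,
    smul_pow, smul_mul_smul_comm, Nat.factorial, pow_zero, pow_one]
  push_cast
  module

end TimeSymmetric

section Estimates

variable {A : Type*} [NormedRing A] [NormedAlgebra ℂ A] {H : ℝ → A} {T s : ℝ}

theorem norm_Omega1_le (hT : 0 ≤ T) (hs : (∫ t in (0 : ℝ)..T, ‖H t‖) ≤ s) : ‖Omega1 H T‖ ≤ s :=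
  (intervalIntegral.norm_integral_le_integral_norm hT).trans hs

theorem Utar_eq_exp (H : ℝ → A) (T : ℝ) : Utar H T = exp (-(Complex.I • Omega1 H T)) := by
  rw [Utar, Omega1, neg_smul]

variable [CompleteSpace A]

theorem norm_Omega3_le (hT : 0 ≤ T) (hH : IntegrableOn H (Set.Icc 0 T))
    (hsymm : ∀ t ∈ Set.Icc 0 T, H t = H (T - t)) (hs : (∫ t in (0 : ℝ)..T, ‖H t‖) ≤ s) :
    ‖Omega3 H T‖ ≤ 2 * s ^ 3 := by
  have hnonneg : 0 ≤ ∫ t in (0 : ℝ)..T, ‖H t‖ :=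
    intervalIntegral.integral_nonneg hT fun _ _ => norm_nonneg _
  have hD : ‖dyson H 3 T‖ ≤ s ^ 3 :=
    (norm_dyson_succ_le hT hH 2).trans (pow_le_pow_left₀ hnonneg hs 3)
  have hΩ : ‖Omega1 H T ^ 3‖ ≤ s ^ 3 :=
    (norm_pow_le' _ three_pos).trans
      (pow_le_pow_left₀ (norm_nonneg _) (norm_Omega1_le hT hs) 3)
  rw [← add_sub_cancel_left ((1 / 6 : ℂ) • Omega1 H T ^ 3) (Omega3 H T),
    ← dyson_three_eq hT hH hsymm]
  refine (norm_sub_le _ _).trans ?_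
  rw [norm_smul, show ‖(1 / 6 : ℂ)‖ = 1 / 6 by norm_num]
  linarith [norm_nonneg (Omega1 H T ^ 3)]

theorem hasSum_timeOrderedExp (hT : 0 ≤ T) (hH : IntegrableOn H (Set.Icc 0 T))
    (hs : (∫ t in (0 : ℝ)..T, ‖H t‖) < 1) :
    HasSum (fun n : ℕ => (-Complex.I) ^ n • dyson H n T) (timeOrderedExp H T) := by
  have hnonneg : 0 ≤ ∫ t in (0 : ℝ)..T, ‖H t‖ :=
    intervalIntegral.integral_nonneg hT fun _ _ => norm_nonneg _
  have hsummable : Summable fun n : ℕ => (-Complex.I) ^ n • dyson H n T := by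
    refine (summable_nat_add_iff 1).1 (.of_norm_bounded
      ((summable_nat_add_iff 1).2 (summable_geometric_of_lt_one hnonneg hs)) fun n => ?_)
    simpa [norm_smul] using norm_dyson_succ_le hT hH n
  simpa only [timeOrderedExp, orderedIntegral_prod_ofFn hT hH] using hsummable.hasSum

theorem norm_timeOrderedExp_sub_sum_le (hT : 0 ≤ T) (hH : IntegrableOn H (Set.Icc 0 T))
    (hs : (∫ t in (0 : ℝ)..T, ‖H t‖) ≤ s) (hs1 : s < 1) (N : ℕ) :
    ‖timeOrderedExp H T - ∑ n ∈ Finset.range (N + 1), (-Complex.I) ^ n • dyson H n T‖ ≤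
      s ^ (N + 1) / (1 - s) := by
  have hnonneg : 0 ≤ ∫ t in (0 : ℝ)..T, ‖H t‖ :=
    intervalIntegral.integral_nonneg hT fun _ _ => norm_nonneg _
  have hsum : HasSum (fun n : ℕ => (-Complex.I) ^ (n + 1) • dyson H (n + 1) T)
      (timeOrderedExp H T - dyson H 0 T) := by
    have h := (hasSum_nat_add_iff' (f := fun n : ℕ => (-Complex.I) ^ n • dyson H n T) 1).2
      (hasSum_timeOrderedExp hT hH (hs.trans_lt hs1))
    simpa only [Finset.sum_range_one, pow_zero, one_smul] using h
  rw [Finset.sum_range_succ', pow_zero, one_smul, add_comm, ← sub_sub, norm_sub_rev, pow_succ']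
  refine norm_sub_le_of_geometric_bound_of_hasSum hs1 (fun n => ?_) hsum N
  rw [← pow_succ', norm_smul, norm_pow, norm_neg, Complex.norm_I, one_pow, one_mul]
  exact (norm_dyson_succ_le hT hH n).trans (pow_le_pow_left₀ hnonneg hs (n + 1))

theorem norm_timeOrderedExp_sub_expAddApprox_le (hT : 0 ≤ T) (hH : IntegrableOn H (Set.Icc 0 T))
    (hsymm : ∀ t ∈ Set.Icc 0 T, H t = H (T - t)) (hs : (∫ t in (0 : ℝ)..T, ‖H t‖) ≤ s)
    (hs2 : s ≤ 1 / 2) :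
    ‖timeOrderedExp H T - expAddApprox (-(Complex.I • Omega1 H T)) (Complex.I • Omega3 H T)‖ ≤
      4 * s ^ 5 := by
  have hU := norm_timeOrderedExp_sub_sum_le hT hH hs (by linarith) 4
  have hx : ‖-(Complex.I • Omega1 H T)‖ ≤ s := by simpa [norm_smul] using norm_Omega1_le hT hs
  have hexp := norm_exp_sub_sum_le hx (by linarith) 4
  have hI : (-Complex.I) ^ 3 = Complex.I := by
    rw [neg_pow, Complex.I_pow_three]
    norm_num
  have hsum := sum_range_five_smul_dyson_eq hT hH hsymm (-Complex.I)
  rw [hI, neg_smul] at hsum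
  have hsplit : timeOrderedExp H T -
        expAddApprox (-(Complex.I • Omega1 H T)) (Complex.I • Omega3 H T) =
      (timeOrderedExp H T - ∑ n ∈ Finset.range 5, (-Complex.I) ^ n • dyson H n T) -
        (exp (-(Complex.I • Omega1 H T)) -
          ∑ n ∈ Finset.range 5, (n.factorial : ℂ)⁻¹ • (-(Complex.I • Omega1 H T)) ^ n) := by
    rw [hsum, expAddApprox]
    abel
  have htail : s ^ 5 / (1 - s) ≤ 2 * s ^ 5 := by
    have : 0 ≤ s ^ 5 := pow_nonneg ((norm_nonneg _).trans hx) 5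
    rw [div_le_iff₀ (by linarith)]
    nlinarith
  rw [hsplit]
  exact (norm_sub_le_of_le (hU.trans htail) (hexp.trans htail)).trans_eq (by ring)

theorem exists_timeOrderedExp_eq_exp (hT : 0 ≤ T) (hH : IntegrableOn H (Set.Icc 0 T))
    (hsymm : ∀ t ∈ Set.Icc 0 T, H t = H (T - t)) (hs : (∫ t in (0 : ℝ)..T, ‖H t‖) ≤ s)
    (hs20 : s ≤ 1 / 20) :
    ∃ R : A, ‖R‖ ≤ 20 * s ^ 5 ∧
      timeOrderedExp H T = exp (-(Complex.I • Omega1 H T) + Complex.I • Omega3 H T + R) := by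
  set x := -(Complex.I • Omega1 H T)
  set y := Complex.I • Omega3 H T
  have hx : ‖x‖ ≤ s := by simpa [x, norm_smul] using norm_Omega1_le hT hs
  have hy : ‖y‖ ≤ 2 * s ^ 3 := by simpa [y, norm_smul] using norm_Omega3_le hT hH hsymm hs
  have hs0 : 0 ≤ s := (norm_nonneg x).trans hx
  have hpow : ∀ n, s ^ n ≤ (1 / 20) ^ n := pow_le_pow_left₀ hs0 hs20
  have hxy : ‖x‖ + ‖y‖ ≤ 11 / 10 * s := by nlinarith [hpow 2]
  have hU : ‖timeOrderedExp H T - exp (x + y)‖ ≤ 10 * s ^ 5 :=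
    calc ‖timeOrderedExp H T - exp (x + y)‖
        ≤ ‖timeOrderedExp H T - expAddApprox x y‖ + ‖exp (x + y) - expAddApprox x y‖ := by
          rw [norm_sub_rev (exp (x + y))]
          exact norm_sub_le_norm_sub_add_norm_sub _ _ _
      _ ≤ 4 * s ^ 5 + (2 * (11 / 10 * s) ^ 2 * (2 * s ^ 3) + (2 * s ^ 3) ^ 2) := by
          refine add_le_add
            (norm_timeOrderedExp_sub_expAddApprox_le hT hH hsymm hs (by linarith))
            ((norm_exp_add_sub_expAddApprox_le (by linarith)).trans ?_)
          gcongr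
      _ ≤ 10 * s ^ 5 := by nlinarith [pow_nonneg hs0 5]
  obtain ⟨R, hR, hexp⟩ := exists_exp_add_eq (u := timeOrderedExp H T) (x := x + y)
    ((norm_add_le x y).trans (by linarith)) (hU.trans (by linarith [hpow 5]))
  exact ⟨R, hR.trans (by linarith), hexp.symm⟩

theorem norm_timeOrderedExp_sub_Utar_le (hT : 0 ≤ T) (hH : IntegrableOn H (Set.Icc 0 T))
    (hsymm : ∀ t ∈ Set.Icc 0 T, H t = H (T - t)) (hs : (∫ t in (0 : ℝ)..T, ‖H t‖) ≤ s)
    (hs2 : s ≤ 1 / 2) : ‖timeOrderedExp H T - Utar H T‖ ≤ 5 * s ^ 3 := by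
  rw [Utar_eq_exp]
  set x := -(Complex.I • Omega1 H T)
  set y := Complex.I • Omega3 H T
  have hx : ‖x‖ ≤ s := by simpa [x, norm_smul] using norm_Omega1_le hT hs
  have hy : ‖y‖ ≤ 2 * s ^ 3 := by simpa [y, norm_smul] using norm_Omega3_le hT hH hsymm hs
  have hs0 : 0 ≤ s := (norm_nonneg x).trans hx
  calc ‖timeOrderedExp H T - exp x‖
      ≤ ‖timeOrderedExp H T - expAddApprox x y‖ + ‖expAddApprox x y - exp x‖ :=
        norm_sub_le_norm_sub_add_norm_sub _ _ _
    _ ≤ 4 * s ^ 5 + 2 * (2 * s ^ 3) := by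
        refine add_le_add (norm_timeOrderedExp_sub_expAddApprox_le hT hH hsymm hs hs2)
          ((norm_expAddApprox_sub_exp_le (by linarith)).trans (by linarith))
    _ ≤ 5 * s ^ 3 := by
        have : s ^ 2 ≤ 1 / 4 := by nlinarith
        nlinarith [pow_nonneg hs0 3]

theorem exists_conj_timeOrderedExp_eq_exp (hT : 0 ≤ T) (hH : IntegrableOn H (Set.Icc 0 T))
    (hsymm : ∀ t ∈ Set.Icc 0 T, H t = H (T - t)) (hs : (∫ t in (0 : ℝ)..T, ‖H t‖) ≤ s)
    (hs20 : s ≤ 1 / 20) :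
    ∃ R : A, ‖R‖ ≤ 54 * s ^ 5 ∧
      exp ((-(1 / 2) : ℂ) • -(Complex.I • Omega1 H T)) * timeOrderedExp H T *
          exp ((-(1 / 2) : ℂ) • -(Complex.I • Omega1 H T)) =
        exp (Complex.I • Omega3 H T + R) := by
  set x := -(Complex.I • Omega1 H T)
  set y := Complex.I • Omega3 H T
  have hx : ‖x‖ ≤ s := by simpa [x, norm_smul] using norm_Omega1_le hT hs
  have hy : ‖y‖ ≤ 2 * s ^ 3 := by simpa [y, norm_smul] using norm_Omega3_le hT hH hsymm hs
  have hs0 : 0 ≤ s := (norm_nonneg x).trans hx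
  have hpow : ∀ n, s ^ n ≤ (1 / 20) ^ n := pow_le_pow_left₀ hs0 hs20
  have hy8 : ‖y‖ ≤ 1 / 8 := by linarith [hpow 3]
  set V := exp ((-(1 / 2) : ℂ) • x) * timeOrderedExp H T * exp ((-(1 / 2) : ℂ) • x)
  have hV : ‖V - exp y‖ ≤ 27 * s ^ 5 :=
    calc ‖V - exp y‖
        ≤ 4 * ‖timeOrderedExp H T - expAddApprox x y‖ + 5 * ‖x‖ ^ 2 * ‖y‖ + 2 * ‖y‖ ^ 2 :=
          norm_conj_sub_exp_le (by linarith) (by linarith) _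
      _ ≤ 4 * (4 * s ^ 5) + 5 * s ^ 2 * (2 * s ^ 3) + 2 * (2 * s ^ 3) ^ 2 := by
          have := norm_timeOrderedExp_sub_expAddApprox_le hT hH hsymm hs (by linarith)
          gcongr
      _ ≤ 27 * s ^ 5 := by nlinarith [pow_nonneg hs0 5]
  obtain ⟨R, hR, hexp⟩ := exists_exp_add_eq hy8 (hV.trans (by linarith [hpow 5]))
  exact ⟨R, hR.trans (by linarith), hexp.symm⟩

end Estimates

section CStarAlgebra

variable {A : Type*} [CStarAlgebra A] {x : A}

theorem cfc_cpow_exp [IsStarNormal x] (hx : ‖x‖ < Real.pi) (a : ℂ) :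
    cfc (fun z : ℂ => z ^ a) (exp x) = exp (a • x) := by
  cases subsingleton_or_nontrivial A
  · exact Subsingleton.elim _ _
  have him : ∀ z ∈ spectrum ℂ x, |z.im| < Real.pi := fun z hz =>
    ((Complex.abs_im_le_norm z).trans (spectrum.norm_le_norm_of_mem hz)).trans_lt hx
  have hcont : ContinuousOn (fun z : ℂ => z ^ a) (Complex.exp '' spectrum ℂ x) := by
    rintro _ ⟨z, hz, rfl⟩
    obtain ⟨hl, hr⟩ := abs_lt.1 (him z hz)
    refine (continuousAt_cpow_const (Complex.exp_mem_slitPlane.2 ?_)).continuousWithinAt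
    rw [(toIocMod_eq_self Real.two_pi_pos).2 ⟨hl, by linarith⟩]
    exact hr.ne
  rw [← CFC.complex_exp_eq_normedSpace_exp (a := x),
    ← CFC.complex_exp_eq_normedSpace_exp (a := a • x),
    ← cfc_comp' (fun z : ℂ => z ^ a) Complex.exp x hcont, ← cfc_comp_smul a Complex.exp x]
  refine cfc_congr fun z hz => ?_
  have hlog := Complex.log_exp (abs_lt.1 (him z hz)).1 (abs_lt.1 (him z hz)).2.le
  simp only [Complex.cpow_def_of_ne_zero (Complex.exp_ne_zero z), hlog, smul_eq_mul, mul_comm]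

theorem isSelfAdjoint_Omega1 {H : ℝ → A} {T : ℝ} (hT : 0 ≤ T)
    (hH : ∀ t ∈ Set.Icc 0 T, IsSelfAdjoint (H t)) : IsSelfAdjoint (Omega1 H T) := by
  rw [Omega1, intervalIntegral.integral_of_le hT, IsSelfAdjoint]
  refine ((starL' ℝ : A ≃L[ℝ] A).integral_comp_comm H).symm.trans ?_
  exact setIntegral_congr_fun measurableSet_Ioc fun t ht => hH t ⟨ht.1.le, ht.2⟩

theorem cfc_cpow_Utar {H : ℝ → A} {T : ℝ} (hnormal : IsStarNormal (Omega1 H T))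
    (hΩ : ‖Omega1 H T‖ < Real.pi) (a : ℂ) :
    cfc (fun z : ℂ => z ^ a) (Utar H T) = exp (a • -(Complex.I • Omega1 H T)) := by
  rw [Utar_eq_exp, ← neg_smul]
  exact cfc_cpow_exp (by simpa [norm_smul] using hΩ) a

end CStarAlgebra

section BoundedFamily

variable {E : Type*} [NormedAddCommGroup E] {H : ℝ → E} {K T : ℝ}

theorem integrableOn_Icc_of_norm_le (hm : AEStronglyMeasurable H (volume.restrict (Set.Icc 0 T)))
    (hK : ∀ t ∈ Set.Icc 0 T, ‖H t‖ ≤ K) : IntegrableOn H (Set.Icc 0 T) :=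
  IntegrableOn.of_bound measure_Icc_lt_top hm K (ae_restrict_of_forall_mem measurableSet_Icc hK)

theorem integral_norm_le_mul (hT : 0 ≤ T) (hH : IntegrableOn H (Set.Icc 0 T))
    (hK : ∀ t ∈ Set.Icc 0 T, ‖H t‖ ≤ K) : (∫ t in (0 : ℝ)..T, ‖H t‖) ≤ K * T := by
  have hint : IntervalIntegrable (fun t => ‖H t‖) volume 0 T :=
    (intervalIntegrable_iff_integrableOn_Icc_of_le hT).2 hH.norm
  refine (intervalIntegral.integral_mono_on hT hint intervalIntegrable_const hK).trans_eq ?_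
  rw [intervalIntegral.integral_const, sub_zero, smul_eq_mul, mul_comm]

end BoundedFamily

end Magnus

theorem mainTheorem3_general :
    ∃ c : ℝ, 0 < c ∧ ∃ C : ℝ, 0 < C ∧
      ∀ (A : Type*) [CStarAlgebra A] (H : ℝ → A) (T s : ℝ),
        0 ≤ T →
        IntegrableOn H (Set.Icc 0 T) →
        (∫ t in (0 : ℝ)..T, ‖H t‖) ≤ s →
        IsStarNormal (Magnus.Omega1 H T) →
        (∀ t ∈ Set.Icc 0 T, H t = H (T - t)) →
        Magnus.Omega2 H T = 0 ∧
        Magnus.Omega4 H T = 0 ∧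
        ‖Magnus.Omega3 H T‖ ≤ C * s ^ 3 ∧
        (s ≤ c →
          (∃ R : A, ‖R‖ ≤ C * s ^ 5 ∧
            Magnus.timeOrderedExp H T =
              NormedSpace.exp
                (-(Complex.I • Magnus.Omega1 H T) + Complex.I • Magnus.Omega3 H T + R)) ∧
          ‖Magnus.timeOrderedExp H T - Magnus.Utar H T‖ ≤ C * s ^ 3 ∧
          (∃ R : A, ‖R‖ ≤ C * s ^ 5 ∧
            cfc (fun z : ℂ => z ^ (-(1 / 2) : ℂ)) (Magnus.Utar H T) * Magnus.timeOrderedExp H T *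
                cfc (fun z : ℂ => z ^ (-(1 / 2) : ℂ)) (Magnus.Utar H T) =
              NormedSpace.exp (Complex.I • Magnus.Omega3 H T + R))) := by
  refine ⟨1 / 20, by norm_num, 54, by norm_num, fun A _ H T s hT hH hs hnormal hsymm => ?_⟩
  have hΩ : ‖Magnus.Omega1 H T‖ ≤ s := Magnus.norm_Omega1_le hT hs
  have hs0 : 0 ≤ s := (norm_nonneg _).trans hΩ
  have hs3 := pow_nonneg hs0 3
  have hs5 := pow_nonneg hs0 5
  refine ⟨Magnus.Omega2_eq_zero hsymm, Magnus.Omega4_eq_zero hsymm,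
    (Magnus.norm_Omega3_le hT hH hsymm hs).trans (by linarith), fun hsc => ⟨?_, ?_, ?_⟩⟩
  · obtain ⟨R, hR, hU⟩ := Magnus.exists_timeOrderedExp_eq_exp hT hH hsymm hs hsc
    exact ⟨R, hR.trans (by linarith), hU⟩
  · exact (Magnus.norm_timeOrderedExp_sub_Utar_le hT hH hsymm hs (by linarith)).trans (by linarith)
  · rw [Magnus.cfc_cpow_Utar hnormal (by linarith [Real.pi_gt_three])]
    exact Magnus.exists_conj_timeOrderedExp_eq_exp hT hH hsymm hs hsc

theorem mainTheorem3 :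
    ∃ c : ℝ, 0 < c ∧ ∃ C : ℝ, 0 < C ∧
      ∀ (E : Type*) [NormedAddCommGroup E] [InnerProductSpace ℂ E] [CompleteSpace E]
        (H : ℝ → E →L[ℂ] E) (K δT : ℝ),
        0 < δT →
        AEStronglyMeasurable H (volume.restrict (Set.Icc 0 δT)) →
        (∀ t ∈ Set.Icc 0 δT, IsSelfAdjoint (H t)) →
        (∀ t ∈ Set.Icc 0 δT, ‖H t‖ ≤ K) →
        (∀ t ∈ Set.Icc 0 δT, H t = H (δT - t)) →
        Magnus.Omega2 H δT = 0 ∧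
        Magnus.Omega4 H δT = 0 ∧
        ‖Magnus.Omega3 H δT‖ ≤ C * (K * δT) ^ 3 ∧
        (K * δT ≤ c →
          (∃ R : E →L[ℂ] E, ‖R‖ ≤ C * (K * δT) ^ 5 ∧
            Magnus.timeOrderedExp H δT =
              NormedSpace.exp
                (-(Complex.I • Magnus.Omega1 H δT) + Complex.I • Magnus.Omega3 H δT + R)) ∧
          ‖Magnus.timeOrderedExp H δT - Magnus.Utar H δT‖ ≤ C * (K * δT) ^ 3 ∧
          (∃ R : E →L[ℂ] E, ‖R‖ ≤ C * (K * δT) ^ 5 ∧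
            Magnus.invSqrt (Magnus.Utar H δT) * Magnus.timeOrderedExp H δT *
                Magnus.invSqrt (Magnus.Utar H δT) =
              NormedSpace.exp (Complex.I • Magnus.Omega3 H δT + R))) := by
  obtain ⟨c, hc, C, hC, h⟩ := mainTheorem3_general
  refine ⟨c, hc, C, hC, fun E _ _ _ H K δT hδT hm hsa hK hsymm => ?_⟩
  have hH := Magnus.integrableOn_Icc_of_norm_le hm hK
  exact h (E →L[ℂ] E) H δT (K * δT) hδT.le hH (Magnus.integral_norm_le_mul hδT.le hH hK)
    (Magnus.isSelfAdjoint_Omega1 hδT.le hsa).isStarNormal hsymm
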